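/- Let $p,q\ge 1$ and $r\ge 0$ be integers, let $(i,j)\in[p]\times[q]$ and let $E=([p]\times[q])\setminus\{(i,j)\}$. For a partial matrix $M_E\in\mathbb{R}^E$ (all entries known except the $(i,j)$ entry), let $M_{\hat i,:}$, $M_{:,\hat j}$ and $M_{\hat i,\hat j}$ be the fully observed submatrices obtained by deleting row $i$, column $j$, and both row $i$ and column $j$, respectively. A completion of $M_E$ is a matrix in $\mathbb{R}^{p\times q}$ that agrees with $M_E$ on $E$. Let $\mathcal{V}_r$ be the variety of real $p\times q$ matrices of rank at most $r$ and $\pi_E:\mathcal{V}_r\to\mathbb{R}^E$ the projection that forgets the $(i,j)$ entry; its singular locus is the set of $M\in\mathcal{V}_r$ at which the differential $d\pi_E:T_M\mathcal{V}_r\to\mathbb{R}^E$ on the Zariski tangent space does not have full rank $\dim T_M\mathcal{V}_r$. The nonnegative rank of a matrix $M$ with nonnegative entries is the smallest $s\in\mathbb{N}$ such that $M=AB$ with $A\in\mathbb{R}_{\ge 0}^{p\times s}$ and $B\in\mathbb{R}_{\ge 0}^{s\times q}$. Consider the following two conditions on $M_E$: (a) $M_{\hat i,:}$ or $M_{:,\hat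 j}$ has rank at most $r-1$; (b) $M_{\hat i,:}$, $M_{:,\hat j}$ and $M_{\hat i,\hat j}$ all have rank exactly $r$. Then the following hold. 1. A partial matrix $M_E$ has a completion of rank at most $r$ if and only if (a) or (b) holds. Condition (a) holds if and only if $M_E$ lies in the image under $\pi_E$ of the singular locus of $\pi_E$. 2. $M_E$ has infinitely many completions of rank at most $r$ if and only if (a) holds, equivalently if and only if $M_E$ lies in the image under $\pi_E$ of the singular locus of $\pi_E$. Moreover, in this case every real number, used as the missing entry, gives a completion of rank at most $r$. 3. $M_E$ has a unique completion of rank at most $r$ if and only if (b) holds. If $M_E$ has at least one completion of rank at most $r$, this is also equivalent to the existence of a nonzero $r\times r$ minor of $M_{\hat i,\hat j}$. 4. If $r\ge 3$, $p>r$ and $q>r$, then there is a partial matrix $M_E\in\mathbb{R}^E$ that has a completion of rank at most $r$ with nonnegative entries, but has no completion of nonnegative rank at most $r$. That is, whether $M_E$ has a completion of nonnegative rank at most $r$ is not determined by whether it has a completion of rank at most $r$ with nonnegative entries. -/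

import Mathlib

open MvPolynomial

/-! ### Partial matrices and their completions -/

/-- A partial `p × q` real matrix with set of observed entries `E`. -/
abbrev PartialMatrix {p q : ℕ} (E : Finset (Fin p × Fin q)) : Type := E → ℝ

namespace PartialMatrix

variable {p q : ℕ} {E : Finset (Fin p × Fin q)}

/-- `M` is a completion of the partial matrix `N`: it agrees with `N` on all observed entries. -/
def IsCompletion (N : PartialMatrix E) (M : Matrix (Fin p) (Fin q) ℝ) : Prop :=
  ∀ e : E, M e.1.1 e.1.2 = N e

/-- The completions of `N` of rank at most `r`. -/
def rankCompletions (N : PartialMatrix E) (r : ℕ) : Set (Matrix (Fin p) (Fin q) ℝ) :=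
  {M | N.IsCompletion M ∧ M.rank ≤ r}

/-- The submatrix of a partial matrix with rows `I` and columns `J`, all of whose entries
are observed. -/
def submatrix (N : PartialMatrix E) (I : Finset (Fin p)) (J : Finset (Fin q))
    (h : I ×ˢ J ⊆ E) : Matrix I J ℝ :=
  Matrix.of fun k l => N ⟨(k.1, l.1), h (Finset.mk_mem_product k.2 l.2)⟩

end PartialMatrix

/-- All positions of a `p × q` matrix except `(i, j)`. -/
abbrev allBut {p q : ℕ} (i : Fin p) (j : Fin q) : Finset (Fin p × Fin q) := {(i, j)}ᶜ

namespace PartialMatrix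

variable {p q : ℕ} {i : Fin p} {j : Fin q}

/-- The observed submatrix obtained by deleting row `i`. -/
def deleteRow (N : PartialMatrix (allBut i j)) :
    Matrix ({i}ᶜ : Finset (Fin p)) (Finset.univ : Finset (Fin q)) ℝ :=
  N.submatrix {i}ᶜ Finset.univ (by
    rintro ⟨k, l⟩ h
    simp at h ⊢
    exact fun hk => absurd hk h)

/-- The observed submatrix obtained by deleting column `j`. -/
def deleteCol (N : PartialMatrix (allBut i j)) :
    Matrix (Finset.univ : Finset (Fin p)) ({j}ᶜ : Finset (Fin q)) ℝ :=
  N.submatrix Finset.univ {j}ᶜ (by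
    rintro ⟨k, l⟩ h
    simp at h ⊢
    exact fun _ => h)

/-- The observed submatrix obtained by deleting row `i` and column `j`. -/
def deleteRowCol (N : PartialMatrix (allBut i j)) :
    Matrix ({i}ᶜ : Finset (Fin p)) ({j}ᶜ : Finset (Fin q)) ℝ :=
  N.submatrix {i}ᶜ {j}ᶜ (by
    rintro ⟨k, l⟩ h
    simp at h ⊢
    exact fun _ => h.2)

end PartialMatrix

/-- Some `r × r` minor of `M` is nonzero. -/
def HasNonzeroMinor {m n : Type*} (M : Matrix m n ℝ) (r : ℕ) : Prop :=
  ∃ (f : Fin r ↪ m) (g : Fin r ↪ n), (M.submatrix f g).det ≠ 0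

/-! ### Nonnegative rank -/

/-- `M = A * B` for entrywise nonnegative `A` and `B` of inner size `r`. -/
def HasNonnegFactorization {p q : ℕ} (M : Matrix (Fin p) (Fin q) ℝ) (r : ℕ) : Prop :=
  ∃ (A : Matrix (Fin p) (Fin r) ℝ) (B : Matrix (Fin r) (Fin q) ℝ),
    (∀ k s, 0 ≤ A k s) ∧ (∀ s l, 0 ≤ B s l) ∧ M = A * B

/-- The nonnegative rank: the smallest size of a nonnegative factorization
(`⊤` if there is none, i.e. if `M` has a negative entry). -/
noncomputable def nonnegRank {p q : ℕ} (M : Matrix (Fin p) (Fin q) ℝ) : ℕ∞ :=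
  sInf {n : ℕ∞ | ∃ r : ℕ, n = r ∧ HasNonnegFactorization M r}

/-! ### Singular locus of a polynomial map on a real variety -/

section SingularLocus

variable {σ τ : Type*} [Fintype σ]

/-- The Zariski tangent space at `x` of a real variety `X` in affine space: the common kernel of
the differentials at `x` of all polynomials vanishing on `X`. -/
def zariskiTangentSpace (X : Set (σ → ℝ)) (x : σ → ℝ) : Submodule ℝ (σ → ℝ) where
  carrier := {v | ∀ f ∈ vanishingIdeal ℝ X, ∑ k, eval x (pderiv k f) * v k = 0}
  zero_mem' := by intro f _; simp
  add_mem' := by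
    intro v w hv hw f hf
    simp [mul_add, Finset.sum_add_distrib, hv f hf, hw f hf]
  smul_mem' := by
    intro c v hv f hf
    have h := hv f hf
    simp only [Pi.smul_apply, smul_eq_mul, mul_left_comm _ c, ← Finset.mul_sum, h, mul_zero]

/-- The map of affine spaces with polynomial components `φ`. -/
noncomputable def polyMap (φ : τ → MvPolynomial σ ℝ) (x : σ → ℝ) : τ → ℝ :=
  fun t => eval x (φ t)

/-- The differential at `x` of the polynomial map `φ` (its Jacobian matrix). -/
noncomputable def polyDifferential (φ : τ → MvPolynomial σ ℝ) (x : σ → ℝ) :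
    (σ → ℝ) →ₗ[ℝ] (τ → ℝ) :=
  Matrix.mulVecLin (Matrix.of fun t k => eval x (pderiv k (φ t)))

/-- The singular locus of the polynomial map `φ` on `X`: the points `x ∈ X` at which the
differential, as a map on the tangent space `T_x X`, does not have full rank `dim T_x X`. -/
def singularLocus (φ : τ → MvPolynomial σ ℝ) (X : Set (σ → ℝ)) : Set (σ → ℝ) :=
  {x | x ∈ X ∧
    Module.finrank ℝ ((zariskiTangentSpace X x).map (polyDifferential φ x)) <
      Module.finrank ℝ (zariskiTangentSpace X x)}

end SingularLocus

/-- The variety of `p × q` real matrices of rank at most `r`, in the affine space of their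
entries. -/
def rankVariety (p q r : ℕ) : Set (Fin p × Fin q → ℝ) :=
  {x | (Matrix.of fun k l => x (k, l)).rank ≤ r}

/-- The components of the coordinate projection onto the entries in `E`. -/
noncomputable def coordProj {p q : ℕ} (E : Finset (Fin p × Fin q)) :
    E → MvPolynomial (Fin p × Fin q) ℝ :=
  fun e => X e.1

/-- The image in `ℝ^E` of the singular locus of the coordinate projection from the variety of
matrices of rank at most `r`. -/
noncomputable def singularImage {p q : ℕ} (E : Finset (Fin p × Fin q)) (r : ℕ) :
    Set (PartialMatrix E) :=
  polyMap (coordProj E) '' singularLocus (coordProj E) (rankVariety p q r)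

/-! Restoring one row or column raises the rank by at most one. So in case (a) every real number is
an admissible missing entry. Otherwise a completion `M` of rank at most `r` keeps rank `r` when row
`i` or column `j` is deleted; then row `i` is a combination of the other rows, so the double
deletion has rank `r` too, which is (b). Conversely, under (b) row `i` without column `j` is a
combination of the others, and the same coefficients prescribe a missing entry.

Uniqueness and the singular locus both rest on one polynomial: a nonzero `r × r` minor avoiding row
`i` and column `j`, bordered by them, gives an `(r+1) × (r+1)` minor that vanishes on the variety
and is affine in the missing entry with that minor as slope. Since the projection forgets one
coordinate, it is singular exactly where that coordinate direction is tangent: in (a) the whole line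
lies in the variety, in (b) the nonzero slope excludes it.

For nonnegative rank, take identity plus a 4-cycle: a singular nonnegative matrix of size `r + 1`
whose positive diagonal is a fooling set, and forget an entry on the cycle. The fooling set survives
whatever value is filled in. -/

namespace Matrix

/-! ### Rank under deletion of rows and columns; minors -/

variable {m n m' n' : Type*} [Fintype m] [Fintype n] [Fintype m'] [Fintype n']

/-- If deleting row `i` does not lower the rank, then row `i` is a combination of the others. -/
theorem exists_row_eq_vecMul_of_rank_le (M : Matrix m n ℝ) (f : m' → m) (i : m)
    (h : M.rank ≤ (M.submatrix f id).rank) : ∃ c : m' → ℝ, M i = c ᵥ* M.submatrix f id := by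
  rw [rank_eq_finrank_span_row, rank_eq_finrank_span_row] at h
  have hle : Submodule.span ℝ (Set.range (M.submatrix f id).row) ≤
      Submodule.span ℝ (Set.range M.row) := by
    refine Submodule.span_mono ?_
    rintro _ ⟨k, rfl⟩
    exact ⟨f k, rfl⟩
  have heq := Submodule.eq_of_le_of_finrank_le hle h
  have hi : M i ∈ Submodule.span ℝ (Set.range (M.submatrix f id).row) := by
    rw [heq]
    exact Submodule.subset_span ⟨i, rfl⟩
  rw [← range_vecMulLinear] at hi
  obtain ⟨c, hc⟩ := hi
  exact ⟨c, hc.symm⟩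

theorem rank_le_of_row_eq_vecMul (M : Matrix m n ℝ) (f : m' → m) (i : m)
    (hf : ∀ k, k ≠ i → k ∈ Set.range f) (c : m' → ℝ) (h : M i = c ᵥ* M.submatrix f id) :
    M.rank ≤ (M.submatrix f id).rank := by
  rw [rank_eq_finrank_span_row, rank_eq_finrank_span_row]
  refine Submodule.finrank_mono (Submodule.span_le.2 ?_)
  rintro _ ⟨k, rfl⟩
  by_cases hk : k = i
  · subst hk
    rw [SetLike.mem_coe, ← range_vecMulLinear]
    exact ⟨c, h.symm⟩
  · obtain ⟨k, rfl⟩ := hf k hk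
    exact Submodule.subset_span ⟨k, rfl⟩

theorem rank_le_rank_submatrix_row_add_one (M : Matrix m n ℝ) (f : m' → m) (i : m)
    (hf : ∀ k, k ≠ i → k ∈ Set.range f) : M.rank ≤ (M.submatrix f id).rank + 1 := by
  rw [rank_eq_finrank_span_row, rank_eq_finrank_span_row]
  have hle : Submodule.span ℝ (Set.range M.row) ≤
      Submodule.span ℝ (Set.range (M.submatrix f id).row) ⊔ Submodule.span ℝ {M i} := by
    refine Submodule.span_le.2 ?_
    rintro _ ⟨k, rfl⟩
    by_cases hk : k = i
    · subst hk
      exact Submodule.mem_sup_right (Submodule.mem_span_singleton_self _)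
    · obtain ⟨k, rfl⟩ := hf k hk
      exact Submodule.mem_sup_left (Submodule.subset_span ⟨k, rfl⟩)
  refine (Submodule.finrank_mono hle).trans ((Submodule.finrank_add_le_finrank_add_finrank _ _).trans ?_)
  exact Nat.add_le_add_left ((finrank_span_le_card {M i}).trans (by simp)) _

theorem rank_le_rank_submatrix_col_add_one (M : Matrix m n ℝ) (g : n' → n) (j : n)
    (hg : ∀ k, k ≠ j → k ∈ Set.range g) : M.rank ≤ (M.submatrix id g).rank + 1 := by
  have h := rank_le_rank_submatrix_row_add_one Mᵀ g j hg
  rwa [← transpose_submatrix, rank_transpose, rank_transpose] at h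

/-- If a matrix of rank at most `r` keeps rank `r` after deleting rows, and after deleting columns,
then it keeps rank `r` after deleting both. -/
theorem le_rank_submatrix_of_le (M : Matrix m n ℝ) (f : m' → m) (g : n' → n) (i : m)
    (hf : ∀ k, k ≠ i → k ∈ Set.range f) {r : ℕ} (hM : M.rank ≤ r)
    (hr : r ≤ (M.submatrix f id).rank) (hc : r ≤ (M.submatrix id g).rank) :
    r ≤ (M.submatrix f g).rank := by
  obtain ⟨c, h⟩ := exists_row_eq_vecMul_of_rank_le M f i (hM.trans hr)
  refine hc.trans ?_
  -- The relation expressing row `i` of `M` survives restriction to the columns `g`.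
  refine rank_le_of_row_eq_vecMul (M.submatrix id g) f i hf c ?_
  ext l
  exact congrFun h (g l)

/-- A maximal independent family of rows has `M.rank` members, and any `r` of them stay independent.
-/
theorem exists_embedding_le_rank_submatrix (M : Matrix m n ℝ) {r : ℕ} (h : r ≤ M.rank) :
    ∃ f : Fin r ↪ m, r ≤ (M.submatrix f id).rank := by
  obtain ⟨κ, a, ha, hsp, hli⟩ := exists_linearIndependent' ℝ M.row
  have : Fintype κ := Fintype.ofInjective a ha
  have hcard : r ≤ Fintype.card κ := by
    rwa [rank_eq_finrank_span_row, ← hsp, finrank_span_eq_card hli] at h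
  obtain ⟨e⟩ := Function.Embedding.nonempty_of_card_le (α := Fin r) (β := κ) (by simpa using hcard)
  refine ⟨e.trans ⟨a, ha⟩, ?_⟩
  have hli' : LinearIndependent ℝ (M.submatrix (e.trans ⟨a, ha⟩) id).row := hli.comp e e.injective
  rw [hli'.rank_matrix, Fintype.card_fin]

theorem rank_lt_card_of_mulVec_eq_zero {m n : Type*} [Fintype n] (M : Matrix m n ℝ) (v : n → ℝ)
    (hv : v ≠ 0) (h : M *ᵥ v = 0) : M.rank < Fintype.card n := by
  have hk : 0 < Module.finrank ℝ (LinearMap.ker M.mulVecLin) :=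
    Module.finrank_pos_iff_exists_ne_zero.2 ⟨⟨v, h⟩, fun h => hv (congrArg Subtype.val h)⟩
  have := LinearMap.finrank_range_add_finrank_ker M.mulVecLin
  rw [Module.finrank_fintype_fun_eq_card] at this
  rw [rank]
  omega

theorem hasNonzeroMinor_iff_le_rank (M : Matrix m n ℝ) (r : ℕ) :
    HasNonzeroMinor M r ↔ r ≤ M.rank := by
  constructor
  · rintro ⟨f, g, h⟩
    have := rank_submatrix_le M f g
    rwa [rank_of_det_ne_zero h, Fintype.card_fin] at this
  · intro h
    obtain ⟨f, hf⟩ := exists_embedding_le_rank_submatrix M h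
    -- Transposing lets the row selection be reused for columns.
    rw [← rank_transpose] at hf
    obtain ⟨g, hg⟩ := exists_embedding_le_rank_submatrix _ hf
    rw [← rank_transpose] at hg
    refine ⟨f, g, fun h0 => ?_⟩
    obtain ⟨v, hv, hv0⟩ := exists_mulVec_eq_zero_iff.2 h0
    have hlt := rank_lt_card_of_mulVec_eq_zero _ v hv hv0
    rw [Fintype.card_fin] at hlt
    exact absurd hg (not_le.2 hlt)

theorem det_eq_zero_of_rank_lt {k : ℕ} (A : Matrix (Fin k) (Fin k) ℝ) (h : A.rank < k) :
    A.det = 0 := by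
  by_contra h0
  rw [rank_of_det_ne_zero h0, Fintype.card_fin] at h
  exact lt_irrefl _ h

/-- The determinant is affine in the upper left entry. -/
theorem det_eq_add_mul_of_eq_off_zero_zero {R : Type*} [CommRing R] {k : ℕ}
    (A B : Matrix (Fin (k + 1)) (Fin (k + 1)) R) (t : R)
    (h0 : B 0 0 = A 0 0 + t) (h : ∀ a b, (a, b) ≠ (0, 0) → B a b = A a b) :
    B.det = A.det + t * (A.submatrix Fin.succ Fin.succ).det := by
  -- The cofactors along row 0 omit the only entry where `A` and `B` differ.
  have hs : ∀ b : Fin (k + 1), B.submatrix Fin.succ b.succAbove = A.submatrix Fin.succ b.succAbove := by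
    intro b
    ext a c
    exact h _ _ (by simp)
  have hrow : ∀ b : Fin k, B 0 b.succ = A 0 b.succ := fun b => h _ _ (by simp)
  rw [det_succ_row_zero B, det_succ_row_zero A, Fin.sum_univ_succ, Fin.sum_univ_succ]
  simp only [hs, hrow, h0]
  simp
  ring

end Matrix

/-! ### Partial derivatives and tangent directions along coordinate lines -/

namespace MvPolynomial

variable {σ : Type*}

/-- The restriction of a polynomial to the line through `x` in the direction of coordinate `k`. -/
noncomputable def restrictLine [DecidableEq σ] (x : σ → ℝ) (k : σ) :
    MvPolynomial σ ℝ →ₐ[ℝ] Polynomial ℝ :=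
  aeval fun s => Polynomial.C (x s) + Pi.single (M := fun _ => Polynomial ℝ) k Polynomial.X s

variable [DecidableEq σ]

theorem eval_restrictLine (x : σ → ℝ) (k : σ) (f : MvPolynomial σ ℝ) (t : ℝ) :
    (restrictLine x k f).eval t = eval (x + Pi.single k t) f := by
  induction f using MvPolynomial.induction_on with
  | C a => simp [restrictLine]
  | add f g hf hg => simp [hf, hg]
  | mul_X f s hf =>
    rw [map_mul, Polynomial.eval_mul, hf, map_mul]
    congr 1
    by_cases h : s = k
    · subst h; simp [restrictLine]
    · simp [restrictLine, h]

theorem derivative_restrictLine (x : σ → ℝ) (k : σ) (f : MvPolynomial σ ℝ) :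
    (restrictLine x k f).derivative = restrictLine x k (pderiv k f) := by
  induction f using MvPolynomial.induction_on with
  | C a => simp [restrictLine]
  | add f g hf hg => simp [hf, hg]
  | mul_X f s hf =>
    rw [map_mul, Polynomial.derivative_mul, hf, pderiv_mul, map_add, map_mul, map_mul]
    congr 2
    by_cases h : s = k
    · subst h; simp [restrictLine]
    · simp [restrictLine, h, pderiv_X_of_ne h]

theorem eval_pderiv_eq_eval_derivative (x : σ → ℝ) (k : σ) (f : MvPolynomial σ ℝ) :
    eval x (pderiv k f) = ((restrictLine x k f).derivative).eval 0 := by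
  rw [derivative_restrictLine, eval_restrictLine]
  simp

/-- A polynomial affine along a coordinate line has the slope as its partial derivative. -/
theorem eval_pderiv_of_eval_add_single (x : σ → ℝ) (k : σ) (f : MvPolynomial σ ℝ) (a b : ℝ)
    (h : ∀ t, eval (x + Pi.single k t) f = a + t * b) : eval x (pderiv k f) = b := by
  have hp : restrictLine x k f = Polynomial.C a + Polynomial.X * Polynomial.C b := by
    refine Polynomial.funext fun t => ?_
    rw [eval_restrictLine, h]
    simp
    ring
  rw [eval_pderiv_eq_eval_derivative, hp]
  simp

end MvPolynomial

theorem single_mem_zariskiTangentSpace_iff {σ : Type*} [Fintype σ] [DecidableEq σ]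
    (X : Set (σ → ℝ)) (x : σ → ℝ) (k : σ) :
    Pi.single k 1 ∈ zariskiTangentSpace X x ↔
      ∀ f ∈ vanishingIdeal ℝ X, eval x (pderiv k f) = 0 := by
  refine forall₂_congr fun f _ => ?_
  simp [Pi.single_apply]

theorem single_mem_zariskiTangentSpace_of_line {σ : Type*} [Fintype σ] [DecidableEq σ]
    (X : Set (σ → ℝ)) (x : σ → ℝ) (k : σ) (h : ∀ t : ℝ, x + Pi.single k t ∈ X) :
    Pi.single k 1 ∈ zariskiTangentSpace X x := by
  rw [single_mem_zariskiTangentSpace_iff]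
  intro f hf
  refine eval_pderiv_of_eval_add_single x k f 0 0 fun t => ?_
  have := mem_vanishingIdeal_iff.1 hf _ (h t)
  simpa [aeval_eq_eval] using this

theorem coe_ne_of_mem_compl_singleton {α : Type*} [Fintype α] [DecidableEq α] {a : α}
    (k : ({a}ᶜ : Finset α)) : (k : α) ≠ a :=
  fun h => Finset.mem_compl.1 k.2 (Finset.mem_singleton.2 h)

/-! ### Where a coordinate projection is singular -/

section CoordProj

variable {p q : ℕ}

theorem polyDifferential_coordProj (E : Finset (Fin p × Fin q)) (x v : Fin p × Fin q → ℝ) (e : E) :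
    polyDifferential (coordProj E) x v e = v e := by
  simp [polyDifferential, coordProj, Matrix.mulVec, dotProduct, pderiv_X, Pi.single_apply]

theorem polyMap_coordProj_eq_iff (E : Finset (Fin p × Fin q)) (x : Fin p × Fin q → ℝ)
    (N : PartialMatrix E) :
    polyMap (coordProj E) x = N ↔ N.IsCompletion (Matrix.of fun k l => x (k, l)) := by
  simp [funext_iff, polyMap, coordProj, PartialMatrix.IsCompletion]

/-- The projection forgetting one entry is singular exactly where the tangent space contains the
direction of that entry. -/
theorem mem_singularLocus_allBut_iff (i : Fin p) (j : Fin q) (X : Set (Fin p × Fin q → ℝ))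
    (x : Fin p × Fin q → ℝ) :
    x ∈ singularLocus (coordProj (allBut i j)) X ↔
      x ∈ X ∧ Pi.single (i, j) 1 ∈ zariskiTangentSpace X x := by
  refine and_congr_right fun _ => ?_
  set T := zariskiTangentSpace X x
  set d := polyDifferential (coordProj (allBut i j)) x
  have hsum := LinearMap.finrank_range_add_finrank_ker (d.domRestrict T)
  rw [LinearMap.range_domRestrict] at hsum
  have hiff : Module.finrank ℝ (T.map d) < Module.finrank ℝ T ↔
      0 < Module.finrank ℝ (LinearMap.ker (d.domRestrict T)) := by omega
  refine hiff.trans (Submodule.one_le_finrank_iff.trans ((Submodule.ne_bot_iff _).trans ?_))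
  constructor
  · rintro ⟨⟨v, hvT⟩, hv, hne⟩
    -- A kernel vector vanishes at every observed position, so it is a nonzero multiple of the
    -- coordinate vector at `(i, j)`.
    have hv' : ∀ e : allBut i j, v e = 0 := by
      intro e
      rw [← polyDifferential_coordProj (allBut i j) x v e]
      exact congrFun hv e
    have hvs : v = v (i, j) • Pi.single (i, j) 1 := by
      ext k
      by_cases hk : k = (i, j)
      · subst hk; simp
      · simpa [hk] using hv' ⟨k, by simpa using hk⟩
    have h0 : v (i, j) ≠ 0 := by
      intro h0
      rw [h0, zero_smul] at hvs
      exact hne (Subtype.ext hvs)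
    have := T.smul_mem (v (i, j))⁻¹ hvT
    rwa [hvs, smul_smul, ← hvs, inv_mul_cancel₀ h0, one_smul] at this
  · intro h
    refine ⟨⟨_, h⟩, ?_, ?_⟩
    · ext e
      have he : (e : Fin p × Fin q) ≠ (i, j) := coe_ne_of_mem_compl_singleton e
      change d _ e = 0
      rw [polyDifferential_coordProj]
      exact Pi.single_eq_of_ne he 1
    · intro h0
      have := congrFun (congrArg Subtype.val h0) (i, j)
      simp at this

end CoordProj

/-! ### Bordered minors -/

section Bordered

variable {p q r : ℕ} {i : Fin p} {j : Fin q}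

/-- Prepend the deleted index to a choice of remaining indices. -/
def borderIndex {n r : ℕ} (i : Fin n) (f : Fin r ↪ ({i}ᶜ : Finset (Fin n))) : Fin (r + 1) → Fin n :=
  Fin.cons i fun a => (f a).1

theorem borderIndex_eq_iff {n r : ℕ} (i : Fin n) (f : Fin r ↪ ({i}ᶜ : Finset (Fin n)))
    (a : Fin (r + 1)) : borderIndex i f a = i ↔ a = 0 := by
  refine Fin.cases ?_ (fun a => ?_) a
  · simp [borderIndex]
  · simpa [borderIndex] using coe_ne_of_mem_compl_singleton (f a)

theorem det_bordered_add (M M' : Matrix (Fin p) (Fin q) ℝ) (t : ℝ) (hij : M' i j = M i j + t)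
    (h : ∀ k l, (k, l) ≠ (i, j) → M' k l = M k l)
    (f : Fin r ↪ ({i}ᶜ : Finset (Fin p))) (g : Fin r ↪ ({j}ᶜ : Finset (Fin q))) :
    (M'.submatrix (borderIndex i f) (borderIndex j g)).det =
      (M.submatrix (borderIndex i f) (borderIndex j g)).det +
        t * (M.submatrix (fun a => (f a).1) (fun b => (g b).1)).det := by
  refine Matrix.det_eq_add_mul_of_eq_off_zero_zero _ _ t hij fun a b hab => h _ _ ?_
  simpa [borderIndex_eq_iff] using hab

theorem det_bordered_eq_zero (M : Matrix (Fin p) (Fin q) ℝ) (hM : M.rank ≤ r)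
    (f : Fin r ↪ ({i}ᶜ : Finset (Fin p))) (g : Fin r ↪ ({j}ᶜ : Finset (Fin q))) :
    (M.submatrix (borderIndex i f) (borderIndex j g)).det = 0 :=
  Matrix.det_eq_zero_of_rank_lt _
    (Nat.lt_succ_of_le ((Matrix.rank_submatrix_le _ _ _).trans hM))

/-- The direction of the entry `(i, j)` is not tangent at `x` if some `r × r` minor avoiding
row `i` and column `j` is nonzero. -/
theorem single_notMem_zariskiTangentSpace_rankVariety (x : Fin p × Fin q → ℝ)
    (f : Fin r ↪ ({i}ᶜ : Finset (Fin p))) (g : Fin r ↪ ({j}ᶜ : Finset (Fin q)))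
    (h : (Matrix.of fun a b => x ((f a).1, (g b).1)).det ≠ 0) :
    Pi.single (i, j) 1 ∉ zariskiTangentSpace (rankVariety p q r) x := by
  rw [single_mem_zariskiTangentSpace_iff]
  intro hT
  -- `F` is the bordered minor: it vanishes on the variety, and its derivative in the `(i, j)`
  -- variable is the given `r × r` minor.
  let F : MvPolynomial (Fin p × Fin q) ℝ :=
    (Matrix.of fun a b => X (borderIndex i f a, borderIndex j g b)).det
  have hF : ∀ y, eval y F =
      ((Matrix.of fun k l => y (k, l)).submatrix (borderIndex i f) (borderIndex j g)).det := by
    intro y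
    rw [RingHom.map_det]
    congr 1
    ext a b
    simp
  have hmem : F ∈ vanishingIdeal ℝ (rankVariety p q r) := by
    rw [mem_vanishingIdeal_iff]
    intro y hy
    rw [aeval_eq_eval]
    exact (hF y).trans (det_bordered_eq_zero _ hy f g)
  refine h ?_
  rw [← hT F hmem]
  symm
  refine eval_pderiv_of_eval_add_single x (i, j) F (eval x F) _ fun t => ?_
  rw [hF, hF]
  refine det_bordered_add _ _ t ?_ ?_ f g
  · simp
  · intro k l hkl
    simp [Pi.single_eq_of_ne hkl]

end Bordered

/-! ### Completions of a matrix with one missing entry -/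

namespace PartialMatrix

variable {p q : ℕ} {i : Fin p} {j : Fin q}

/-- The completion of `N` with missing entry `t`. -/
def fill (N : PartialMatrix (allBut i j)) (t : ℝ) : Matrix (Fin p) (Fin q) ℝ :=
  Matrix.of fun k l => if h : (k, l) ∈ allBut i j then N ⟨(k, l), h⟩ else t

theorem isCompletion_fill (N : PartialMatrix (allBut i j)) (t : ℝ) : N.IsCompletion (N.fill t) := by
  intro e
  exact dif_pos e.2

theorem fill_apply_self (N : PartialMatrix (allBut i j)) (t : ℝ) : N.fill t i j = t :=
  dif_neg (by simp)

theorem IsCompletion.apply_eq {N : PartialMatrix (allBut i j)} {M M' : Matrix (Fin p) (Fin q) ℝ}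
    (h : N.IsCompletion M) (h' : N.IsCompletion M') (k : Fin p) (l : Fin q)
    (hkl : (k, l) ≠ (i, j)) : M k l = M' k l :=
  (h ⟨(k, l), by simpa using hkl⟩).trans (h' ⟨(k, l), by simpa using hkl⟩).symm

theorem IsCompletion.eq_of_apply_eq {N : PartialMatrix (allBut i j)}
    {M M' : Matrix (Fin p) (Fin q) ℝ}
    (h : N.IsCompletion M) (h' : N.IsCompletion M') (hij : M i j = M' i j) : M = M' := by
  ext k l
  by_cases hkl : (k, l) = (i, j)
  · obtain ⟨rfl, rfl⟩ := Prod.mk.inj hkl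
    exact hij
  · exact h.apply_eq h' k l hkl

theorem mem_range_val_compl {n : ℕ} (i k : Fin n) (h : k ≠ i) :
    k ∈ Set.range (Subtype.val : ({i}ᶜ : Finset (Fin n)) → Fin n) :=
  ⟨⟨k, by simpa using h⟩, rfl⟩

theorem IsCompletion.rank_deleteRow {N : PartialMatrix (allBut i j)}
    {M : Matrix (Fin p) (Fin q) ℝ} (h : N.IsCompletion M) :
    N.deleteRow.rank = (M.submatrix (Subtype.val : ({i}ᶜ : Finset (Fin p)) → _) id).rank := by
  have heq : N.deleteRow = (M.submatrix (Subtype.val : ({i}ᶜ : Finset (Fin p)) → _) id).submatrix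
      (Equiv.refl _) (Equiv.subtypeUnivEquiv Finset.mem_univ) := by
    ext k l
    exact (h ⟨(k.1, l.1), _⟩).symm
  rw [heq, Matrix.rank_submatrix]

theorem IsCompletion.rank_deleteCol {N : PartialMatrix (allBut i j)}
    {M : Matrix (Fin p) (Fin q) ℝ} (h : N.IsCompletion M) :
    N.deleteCol.rank = (M.submatrix id (Subtype.val : ({j}ᶜ : Finset (Fin q)) → _)).rank := by
  have heq : N.deleteCol = (M.submatrix id (Subtype.val : ({j}ᶜ : Finset (Fin q)) → _)).submatrix
      (Equiv.subtypeUnivEquiv Finset.mem_univ) (Equiv.refl _) := by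
    ext k l
    exact (h ⟨(k.1, l.1), _⟩).symm
  rw [heq, Matrix.rank_submatrix]

theorem IsCompletion.deleteRowCol_eq {N : PartialMatrix (allBut i j)}
    {M : Matrix (Fin p) (Fin q) ℝ} (h : N.IsCompletion M) :
    N.deleteRowCol = M.submatrix Subtype.val Subtype.val := by
  ext k l
  exact (h ⟨(k.1, l.1), _⟩).symm

theorem rank_deleteRowCol_le_deleteRow (N : PartialMatrix (allBut i j)) :
    N.deleteRowCol.rank ≤ N.deleteRow.rank := by
  have h := N.isCompletion_fill 0
  rw [h.rank_deleteRow, h.deleteRowCol_eq]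
  exact Matrix.rank_submatrix_le ((N.fill 0).submatrix Subtype.val id) id Subtype.val

theorem rank_deleteRowCol_le_deleteCol (N : PartialMatrix (allBut i j)) :
    N.deleteRowCol.rank ≤ N.deleteCol.rank := by
  have h := N.isCompletion_fill 0
  rw [h.rank_deleteCol, h.deleteRowCol_eq]
  exact Matrix.rank_submatrix_le ((N.fill 0).submatrix id Subtype.val) Subtype.val id

theorem IsCompletion.rank_deleteRow_le {N : PartialMatrix (allBut i j)}
    {M : Matrix (Fin p) (Fin q) ℝ} (h : N.IsCompletion M) : N.deleteRow.rank ≤ M.rank :=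
  h.rank_deleteRow.trans_le (Matrix.rank_submatrix_le _ _ _)

theorem IsCompletion.rank_deleteCol_le {N : PartialMatrix (allBut i j)}
    {M : Matrix (Fin p) (Fin q) ℝ} (h : N.IsCompletion M) : N.deleteCol.rank ≤ M.rank :=
  h.rank_deleteCol.trans_le (Matrix.rank_submatrix_le _ _ _)

variable {r : ℕ}

theorem IsCompletion.rank_le_of_deficient {N : PartialMatrix (allBut i j)}
    {M : Matrix (Fin p) (Fin q) ℝ} (h : N.IsCompletion M)
    (ha : N.deleteRow.rank < r ∨ N.deleteCol.rank < r) : M.rank ≤ r := by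
  rw [h.rank_deleteRow, h.rank_deleteCol] at ha
  rcases ha with ha | ha
  · exact (M.rank_le_rank_submatrix_row_add_one _ i (mem_range_val_compl i)).trans ha
  · exact (M.rank_le_rank_submatrix_col_add_one _ j (mem_range_val_compl j)).trans ha

theorem deficient_or_of_mem_rankCompletions {N : PartialMatrix (allBut i j)}
    {M : Matrix (Fin p) (Fin q) ℝ} (h : M ∈ N.rankCompletions r) :
    (N.deleteRow.rank < r ∨ N.deleteCol.rank < r) ∨
      (N.deleteRow.rank = r ∧ N.deleteCol.rank = r ∧ N.deleteRowCol.rank = r) := by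
  obtain ⟨hM, hr⟩ := h
  by_cases ha : N.deleteRow.rank < r ∨ N.deleteCol.rank < r
  · exact Or.inl ha
  · right
    push Not at ha
    have h1 := hM.rank_deleteRow_le.trans hr
    have h2 := hM.rank_deleteCol_le.trans hr
    have h3 : r ≤ N.deleteRowCol.rank := by
      rw [hM.deleteRowCol_eq]
      rw [hM.rank_deleteRow, hM.rank_deleteCol] at ha
      exact M.le_rank_submatrix_of_le _ _ i (mem_range_val_compl i) hr ha.1 ha.2
    have h4 := N.rank_deleteRowCol_le_deleteRow
    omega

theorem exists_mem_rankCompletions_of_rank_eq (N : PartialMatrix (allBut i j))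
    (hb : N.deleteRow.rank = r ∧ N.deleteCol.rank = r ∧ N.deleteRowCol.rank = r) :
    (N.rankCompletions r).Nonempty := by
  obtain ⟨h1, h2, h3⟩ := hb
  have h0 := N.isCompletion_fill 0
  have hle : N.deleteCol.rank ≤ N.deleteRowCol.rank := (h2.trans h3.symm).le
  rw [h0.rank_deleteCol, h0.deleteRowCol_eq] at hle
  obtain ⟨c, hc⟩ := Matrix.exists_row_eq_vecMul_of_rank_le
    ((N.fill 0).submatrix id Subtype.val) (Subtype.val : ({i}ᶜ : Finset (Fin p)) → _) i hle
  -- The coefficients `c` were found without column `j`; the missing entry is chosen so that they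
  -- also work there.
  have ht := N.isCompletion_fill (Matrix.vecMul c ((N.fill 0).submatrix Subtype.val id) j)
  set M := N.fill (Matrix.vecMul c ((N.fill 0).submatrix Subtype.val id) j)
  have hsub : M.submatrix (Subtype.val : ({i}ᶜ : Finset (Fin p)) → _) id =
      (N.fill 0).submatrix Subtype.val id := by
    ext k l
    refine ht.apply_eq h0 _ _ fun hkl => ?_
    exact coe_ne_of_mem_compl_singleton k (Prod.mk.inj hkl).1
  refine ⟨M, ht, ?_⟩
  rw [← h1, ht.rank_deleteRow]
  refine Matrix.rank_le_of_row_eq_vecMul M _ i (mem_range_val_compl i) c ?_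
  rw [hsub]
  ext l
  by_cases hl : l = j
  · subst hl
    exact N.fill_apply_self _
  · rw [ht.apply_eq h0 i l (by simp [hl])]
    exact congrFun hc ⟨l, by simpa using hl⟩

/-- The bordered minor vanishes at both completions, yet it is affine in the missing entry with
nonzero slope. -/
theorem eq_of_mem_rankCompletions {N : PartialMatrix (allBut i j)}
    (hN : r ≤ N.deleteRowCol.rank) {M M' : Matrix (Fin p) (Fin q) ℝ}
    (h : M ∈ N.rankCompletions r) (h' : M' ∈ N.rankCompletions r) : M = M' := by
  obtain ⟨f, g, hfg⟩ := (Matrix.hasNonzeroMinor_iff_le_rank _ _).2 hN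
  rw [h.1.deleteRowCol_eq] at hfg
  have hd := det_bordered_add M M' (M' i j - M i j) (by ring) (fun k l => h'.1.apply_eq h.1 k l) f g
  rw [det_bordered_eq_zero M h.2, det_bordered_eq_zero M' h'.2, zero_add] at hd
  refine h.1.eq_of_apply_eq h'.1 ?_
  have := (mul_eq_zero.1 hd.symm).resolve_right hfg
  linarith

theorem fill_mem_rankCompletions (N : PartialMatrix (allBut i j))
    (ha : N.deleteRow.rank < r ∨ N.deleteCol.rank < r) (t : ℝ) :
    N.fill t ∈ N.rankCompletions r :=
  ⟨N.isCompletion_fill t, (N.isCompletion_fill t).rank_le_of_deficient ha⟩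

theorem infinite_rankCompletions_iff (N : PartialMatrix (allBut i j)) :
    (N.rankCompletions r).Infinite ↔ (N.deleteRow.rank < r ∨ N.deleteCol.rank < r) := by
  constructor
  · intro h
    obtain ⟨M, hM⟩ := h.nonempty
    refine (deficient_or_of_mem_rankCompletions hM).resolve_right fun hb => h ?_
    exact Set.Subsingleton.finite fun A hA B hB => eq_of_mem_rankCompletions hb.2.2.ge hA hB
  · intro ha
    refine Set.infinite_of_injective_forall_mem (f := N.fill) (fun s t hst => ?_)
      (N.fill_mem_rankCompletions ha)
    rw [← N.fill_apply_self s, hst, N.fill_apply_self]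

theorem existsUnique_rankCompletion_iff (N : PartialMatrix (allBut i j)) :
    (∃! M, M ∈ N.rankCompletions r) ↔
      (N.deleteRow.rank = r ∧ N.deleteCol.rank = r ∧ N.deleteRowCol.rank = r) := by
  constructor
  · rintro ⟨M, hM, huniq⟩
    refine (deficient_or_of_mem_rankCompletions hM).resolve_left fun ha => ?_
    refine N.infinite_rankCompletions_iff.2 ha (Set.Subsingleton.finite fun A hA B hB => ?_)
    rw [huniq A hA, huniq B hB]
  · intro hb
    obtain ⟨M, hM⟩ := N.exists_mem_rankCompletions_of_rank_eq hb
    exact ⟨M, hM, fun M' hM' => eq_of_mem_rankCompletions hb.2.2.ge hM' hM⟩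

theorem deficient_iff_mem_singularImage (N : PartialMatrix (allBut i j)) :
    (N.deleteRow.rank < r ∨ N.deleteCol.rank < r) ↔ N ∈ singularImage (allBut i j) r := by
  constructor
  · intro ha
    refine ⟨fun k => N.fill 0 k.1 k.2, ?_, ?_⟩
    · rw [mem_singularLocus_allBut_iff]
      refine ⟨(N.fill_mem_rankCompletions ha 0).2, ?_⟩
      -- Moving along this line only changes the missing entry, and under (a) every completion lies
      -- in the variety.
      refine single_mem_zariskiTangentSpace_of_line _ _ _ fun t => ?_
      refine IsCompletion.rank_le_of_deficient (N := N) ?_ ha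
      intro e
      have he : (e : Fin p × Fin q) ≠ (i, j) := coe_ne_of_mem_compl_singleton e
      simpa [Pi.single_eq_of_ne he] using N.isCompletion_fill 0 e
    · rw [polyMap_coordProj_eq_iff]
      exact N.isCompletion_fill 0
  · rintro ⟨x, hx, hN⟩
    rw [mem_singularLocus_allBut_iff] at hx
    rw [polyMap_coordProj_eq_iff] at hN
    refine (deficient_or_of_mem_rankCompletions (M := Matrix.of fun k l => x (k, l))
      ⟨hN, hx.1⟩).resolve_right fun hb => ?_
    obtain ⟨f, g, hfg⟩ := (Matrix.hasNonzeroMinor_iff_le_rank _ _).2 hb.2.2.ge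
    rw [hN.deleteRowCol_eq] at hfg
    exact single_notMem_zariskiTangentSpace_rankVariety x f g hfg hx.2

end PartialMatrix

/-! ### Nonnegative rank and fooling sets -/

theorem exists_embedding_fin_apply_eq {n p : ℕ} (h : n ≤ p) (a : Fin n) (i : Fin p) :
    ∃ f : Fin n ↪ Fin p, f a = i :=
  ⟨(Fin.castLEEmb h).trans (Equiv.swap (Fin.castLE h a) i).toEmbedding, by simp⟩

theorem exists_hasNonnegFactorization_of_nonnegRank_le {p q r : ℕ} {M : Matrix (Fin p) (Fin q) ℝ}
    (h : nonnegRank M ≤ r) : ∃ s ≤ r, HasNonnegFactorization M s := by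
  -- The infimum of the empty set is `⊤`, which no natural number bounds; a nonempty set attains its
  -- infimum.
  have hne : {n : ℕ∞ | ∃ r : ℕ, n = r ∧ HasNonnegFactorization M r}.Nonempty := by
    by_contra hne
    rw [Set.not_nonempty_iff_eq_empty] at hne
    rw [nonnegRank, hne, sInf_empty, top_le_iff] at h
    exact ENat.natCast_ne_top r h
  obtain ⟨s, hs, hM⟩ := csInf_mem hne
  refine ⟨s, ?_, hM⟩
  rw [nonnegRank, hs] at h
  exact_mod_cast h

/-- A nonnegative factorization of inner size less than the number of positive entries `(f a, g a)`
produces two such entries whose opposite corners are both positive. -/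
theorem HasNonnegFactorization.exists_pos_of_lt {p q s n : ℕ} {M : Matrix (Fin p) (Fin q) ℝ}
    (h : HasNonnegFactorization M s) (hs : s < n) (f : Fin n → Fin p) (g : Fin n → Fin q)
    (hpos : ∀ a, 0 < M (f a) (g a)) :
    ∃ a b, a ≠ b ∧ 0 < M (f a) (g b) ∧ 0 < M (f b) (g a) := by
  obtain ⟨A, B, hA, hB, rfl⟩ := h
  have hex : ∀ a, ∃ t, 0 < A (f a) t ∧ 0 < B t (g a) := by
    intro a
    obtain ⟨t, -, ht⟩ := (Finset.sum_pos_iff_of_nonneg fun t _ => mul_nonneg (hA _ t) (hB t _)).1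
      (Matrix.mul_apply (M := A) (N := B) ▸ hpos a)
    exact ⟨t, (hA _ _).lt_of_ne' (left_ne_zero_of_mul ht.ne'),
      (hB _ _).lt_of_ne' (right_ne_zero_of_mul ht.ne')⟩
  choose t htA htB using hex
  -- Two of the `n` entries draw positivity from the same rank-one summand, which is then positive
  -- at the opposite corners too.
  obtain ⟨a, b, hab, htab⟩ := Fintype.exists_ne_map_eq_of_card_lt t (by simpa using hs)
  have key : ∀ a b, t a = t b → 0 < (A * B) (f a) (g b) := by
    intro a b hab
    rw [Matrix.mul_apply]
    exact (Finset.sum_pos_iff_of_nonneg fun t _ => mul_nonneg (hA _ t) (hB t _)).2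
      ⟨t a, Finset.mem_univ _, mul_pos (htA a) (hab ▸ htB b)⟩
  exact ⟨a, b, hab, key a b htab, key b a htab.symm⟩

/-! ### A singular matrix with a large fooling set -/

section FourCycle

variable {n : ℕ}

/-- The map rotating the first four indices and fixing the others. -/
def rotateFour (hn : 4 ≤ n) (a : Fin n) : Fin n :=
  if a.1 < 4 then ⟨(a.1 + 1) % 4, (Nat.mod_lt _ (by decide)).trans_le hn⟩ else a

/-- A 4-cycle contains no 2-cycle, so only fixed points remain. This makes the diagonal a fooling
set. -/
theorem eq_of_rotateFour_eq (hn : 4 ≤ n) {a b : Fin n} (h : b = rotateFour hn a)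
    (h' : a = rotateFour hn b) : a = b := by
  unfold rotateFour at h h'
  split_ifs at h h' <;> simp only [Fin.ext_iff] at * <;> omega

/-- The identity plus the permutation matrix of `rotateFour`. -/
def fourCycleMatrix (hn : 4 ≤ n) : Matrix (Fin n) (Fin n) ℝ :=
  1 + (1 : Matrix (Fin n) (Fin n) ℝ).submatrix (rotateFour hn) id

theorem fourCycleMatrix_apply (hn : 4 ≤ n) (a b : Fin n) :
    fourCycleMatrix hn a b = (if a = b then 1 else 0) + if rotateFour hn a = b then 1 else 0 := by
  simp [fourCycleMatrix, Matrix.one_apply]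

theorem fourCycleMatrix_nonneg (hn : 4 ≤ n) (a b : Fin n) : 0 ≤ fourCycleMatrix hn a b := by
  rw [fourCycleMatrix_apply]
  positivity

theorem fourCycleMatrix_self_pos (hn : 4 ≤ n) (a : Fin n) : 0 < fourCycleMatrix hn a a := by
  rw [fourCycleMatrix_apply, if_pos rfl]
  positivity

theorem eq_rotateFour_of_pos (hn : 4 ≤ n) {a b : Fin n} (hab : a ≠ b)
    (h : 0 < fourCycleMatrix hn a b) : b = rotateFour hn a := by
  by_contra hne
  rw [fourCycleMatrix_apply, if_neg hab, if_neg (Ne.symm hne)] at h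
  simp at h

theorem rank_fourCycleMatrix_lt (hn : 4 ≤ n) : (fourCycleMatrix hn).rank < n := by
  -- The signs 1, -1, 1, -1 alternate consistently around the cycle because its length is even, so
  -- rotation negates `v`.
  let v : Fin n → ℝ := fun a => if a.1 < 4 then (-1) ^ a.1 else 0
  have hv : v ≠ 0 := fun h => by
    have := congrFun h ⟨0, by omega⟩
    simp [v] at this
  have h0 : (fourCycleMatrix hn).mulVec v = 0 := by
    ext a
    have : (fourCycleMatrix hn).mulVec v a = v a + v (rotateFour hn a) := by
      simp [Matrix.mulVec, dotProduct, fourCycleMatrix_apply, add_mul, Finset.sum_add_distrib]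
    rw [this]
    obtain ⟨a, ha⟩ := a
    by_cases h4 : a < 4
    · interval_cases a <;> simp [v, rotateFour] <;> norm_num
    · simp [v, rotateFour, h4]
  simpa using Matrix.rank_lt_card_of_mulVec_eq_zero _ v hv h0

end FourCycle

theorem exists_nonneg_extension {p q n : ℕ} (f : Fin n ↪ Fin p) (g : Fin n ↪ Fin q)
    (C : Matrix (Fin n) (Fin n) ℝ) (hC : ∀ a b, 0 ≤ C a b) :
    ∃ M : Matrix (Fin p) (Fin q) ℝ, M.rank ≤ C.rank ∧ (∀ k l, 0 ≤ M k l) ∧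
      ∀ a b, M (f a) (g b) = C a b := by
  have h1 : ∀ {m : ℕ} (k l : Fin m), 0 ≤ (1 : Matrix (Fin m) (Fin m) ℝ) k l := fun k l => by
    rw [Matrix.one_apply]
    positivity
  -- Multiplying by 0-1 selection matrices places `C` in rows `f` and columns `g`, with zeros
  -- elsewhere.
  refine ⟨(1 : Matrix _ _ ℝ).submatrix id f * C * (1 : Matrix _ _ ℝ).submatrix g id,
    (Matrix.rank_mul_le_left _ _).trans (Matrix.rank_mul_le_right _ _), fun k l => ?_, fun a b => ?_⟩
  · rw [Matrix.mul_apply]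
    refine Finset.sum_nonneg fun b _ => mul_nonneg ?_ (h1 _ _)
    rw [Matrix.mul_apply]
    exact Finset.sum_nonneg fun a _ => mul_nonneg (h1 _ _) (hC _ _)
  · simp [Matrix.mul_apply, Matrix.one_apply]

theorem exists_partialMatrix_nonnegRank_gap (p q r : ℕ) (i : Fin p) (j : Fin q) (hr : 3 ≤ r)
    (hp : r < p) (hq : r < q) :
    ∃ N : PartialMatrix (allBut i j),
      (∃ M ∈ N.rankCompletions r, ∀ k l, 0 ≤ M k l) ∧
      ¬ ∃ M, N.IsCompletion M ∧ nonnegRank M ≤ r := by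
  -- The size `r + 1` must accommodate a 4-cycle, hence `3 ≤ r`.
  have hn : 4 ≤ r + 1 := by omega
  obtain ⟨f, hf⟩ := exists_embedding_fin_apply_eq (Nat.succ_le_of_lt hp) 0 i
  -- The forgotten position is made an off-diagonal entry of the cycle: the diagonal stays observed.
  obtain ⟨g, hg⟩ := exists_embedding_fin_apply_eq (Nat.succ_le_of_lt hq) (rotateFour hn 0) j
  obtain ⟨M₀, hrank, hnonneg, happ⟩ :=
    exists_nonneg_extension f g (fourCycleMatrix hn) (fourCycleMatrix_nonneg hn)
  let N : PartialMatrix (allBut i j) := fun e => M₀ e.1.1 e.1.2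
  have hM₀ : N.IsCompletion M₀ := fun e => rfl
  refine ⟨N, ⟨M₀, ⟨hM₀, ?_⟩, hnonneg⟩, ?_⟩
  · exact hrank.trans (Nat.le_of_lt_succ (rank_fourCycleMatrix_lt hn))
  · rintro ⟨M, hM, hle⟩
    obtain ⟨s, hs, hfac⟩ := exists_hasNonnegFactorization_of_nonnegRank_le hle
    have hrot0 : rotateFour hn 0 ≠ 0 := by simp [rotateFour, Fin.ext_iff]
    have happM : ∀ a b, (a, b) ≠ (0, rotateFour hn 0) → M (f a) (g b) = fourCycleMatrix hn a b := by
      intro a b hab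
      rw [← happ]
      refine hM.apply_eq hM₀ _ _ fun h => hab ?_
      rw [← hf, ← hg] at h
      exact Prod.ext (f.injective (Prod.mk.inj h).1) (g.injective (Prod.mk.inj h).2)
    obtain ⟨a, b, hab, h1, h2⟩ := hfac.exists_pos_of_lt (Nat.lt_succ_of_le hs) f g fun a => by
      rw [happM a a fun h => hrot0 ((Prod.mk.inj h).2.symm.trans (Prod.mk.inj h).1)]
      exact fourCycleMatrix_self_pos hn a
    -- At the forgotten position the conclusion holds by its placement, so its value is irrelevant.
    have key : ∀ a b, a ≠ b → 0 < M (f a) (g b) → b = rotateFour hn a := by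
      intro a b hab h
      by_cases h0 : (a, b) = (0, rotateFour hn 0)
      · rw [(Prod.mk.inj h0).1, (Prod.mk.inj h0).2]
      · rw [happM a b h0] at h
        exact eq_rotateFour_of_pos hn hab h
    exact hab (eq_of_rotateFour_eq hn (key a b hab h1) (key b a hab.symm h2))

/-! ### The main theorem -/

theorem mainTheorem6 (p q r : ℕ) (i : Fin p) (j : Fin q) :
    (∀ N : PartialMatrix (allBut i j),
      -- (1) existence of a completion of rank at most `r`
      ((N.rankCompletions r).Nonempty ↔
        (N.deleteRow.rank < r ∨ N.deleteCol.rank < r) ∨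
        (N.deleteRow.rank = r ∧ N.deleteCol.rank = r ∧ N.deleteRowCol.rank = r)) ∧
      ((N.deleteRow.rank < r ∨ N.deleteCol.rank < r) ↔
        N ∈ singularImage (allBut i j) r) ∧
      -- (2) infinitely many completions
      ((N.rankCompletions r).Infinite ↔
        (N.deleteRow.rank < r ∨ N.deleteCol.rank < r)) ∧
      ((N.rankCompletions r).Infinite ↔ N ∈ singularImage (allBut i j) r) ∧
      ((N.rankCompletions r).Infinite →
        ∀ t : ℝ, ∃ M ∈ N.rankCompletions r, M i j = t) ∧
      -- (3) a unique completion
      ((∃! M, M ∈ N.rankCompletions r) ↔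
        (N.deleteRow.rank = r ∧ N.deleteCol.rank = r ∧ N.deleteRowCol.rank = r)) ∧
      ((N.rankCompletions r).Nonempty →
        ((∃! M, M ∈ N.rankCompletions r) ↔ HasNonzeroMinor N.deleteRowCol r))) ∧
    -- (4) nonnegative completions of rank at most `r` do not decide nonnegative rank
    (3 ≤ r → r < p → r < q →
      ∃ N : PartialMatrix (allBut i j),
        (∃ M ∈ N.rankCompletions r, ∀ k l, 0 ≤ M k l) ∧
        ¬ ∃ M, N.IsCompletion M ∧ nonnegRank M ≤ r) := by
  refine ⟨fun N => ⟨⟨fun ⟨M, hM⟩ => PartialMatrix.deficient_or_of_mem_rankCompletions hM, ?_⟩,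
    N.deficient_iff_mem_singularImage, N.infinite_rankCompletions_iff,
    N.infinite_rankCompletions_iff.trans N.deficient_iff_mem_singularImage, ?_, ?_, ?_⟩,
    exists_partialMatrix_nonnegRank_gap p q r i j⟩
  · rintro (ha | hb)
    · exact ⟨_, N.fill_mem_rankCompletions ha 0⟩
    · exact N.exists_mem_rankCompletions_of_rank_eq hb
  · intro h t
    exact ⟨_, N.fill_mem_rankCompletions (N.infinite_rankCompletions_iff.1 h) t,
      N.fill_apply_self t⟩
  · exact N.existsUnique_rankCompletion_iff
  · rintro ⟨M, hM⟩
    rw [Matrix.hasNonzeroMinor_iff_le_rank, N.existsUnique_rankCompletion_iff]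
    refine ⟨fun hb => hb.2.2.ge, fun h => ?_⟩
    refine (PartialMatrix.deficient_or_of_mem_rankCompletions hM).resolve_left fun ha => ?_
    -- Both larger submatrices have rank at least that of the double deletion, hence at least `r`,
    -- contradicting (a).
    have h1 := N.rank_deleteRowCol_le_deleteRow
    have h2 := N.rank_deleteRowCol_le_deleteCol
    omega
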